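/- Let $\mathrm h>0$, $\bar{\mathrm H}\in\mathbb R$, $\epsilon>0$, and put $$\mathrm C=\mathrm h\,\frac{e^{\epsilon/2}+1}{e^{\epsilon/2}-1},\qquad p=\frac{e^{\epsilon}-e^{\epsilon/2}}{2\mathrm h(e^{\epsilon/2}+1)}.$$ For a bias $\bar{\mathrm A}\in\mathbb R$ and an input $x\in[\bar{\mathrm H}-\mathrm h,\bar{\mathrm H}+\mathrm h]$, the piecewise mechanism has output range $[x^*_{\min},x^*_{\max}]=[\bar{\mathrm H}-\mathrm C+\bar{\mathrm A},\ \bar{\mathrm H}+\mathrm C+\bar{\mathrm A}]$; its density equals $p$ on $[\mathrm L(x),\mathrm R(x)]$ and $p/e^{\epsilon}$ on the rest of the range, where $\mathrm L(x)=\frac{\mathrm C+\mathrm h}{2}\cdot\frac{x-\bar{\mathrm H}}{\mathrm h}-\frac{\mathrm C-\mathrm h}{2}+\bar{\mathrm H}+\bar{\mathrm A}$ and $\mathrm R(x)=\mathrm L(x)+\mathrm C-\mathrm h$. Let $\mathrm{CDF}_x$ be its cumulative distribution function. For a set $Q\subseteq[0,1]$ let $\mathcal I_x(Q)$ be the set of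 outputs of inverse-CDF sampling in IEEE double precision, that is, of all values $\mathrm{fl}(\mathrm{CDF}_x^{-1}(p_C))$, where $p_C$ runs through the doubles in $Q$ and $\mathrm{fl}$ is rounding of a real number to the nearest finite double (with any fixed rule for ties). Let $E_U^{\mathrm{enc}}=\lceil\log_2(2\mathrm C)\rceil$, let $E^*_U$ be an integer with $$E^*_U\ \ge\ \max\left(\left\lceil -1+\log_2\left(e^{\epsilon}/p\right)\right\rceil,\ E_U^{\mathrm{enc}}\right),\qquad -1022<E_U^*\le 1023,$$ and choose $\bar{\mathrm A}=2^{E^*_U+1}-2\cdot\mathrm{ULP}\left(2^{E^*_U}\right)-\bar{\mathrm H}-\mathrm C$, where $\mathrm{ULP}(2^{E^*_U})=2^{E^*_U-52}$. Then for all inputs $x,x'\in[\bar{\mathrm H}-\mathrm h,\bar{\mathrm H}+\mathrm h]$: 1. every double in $[x^*_{\min},x^*_{\max}]$ lies in $\mathcal I_x([0,1])$; 2. every double in $[x^*_{\min},x^*_{\max})$ already lies in $\mathcal I_x([0,1))$; 3. the set of possible outputs does not depend on the input, so no output can be traced back to some inputs only: $\mathcal I_x([0,1])=\mathcal I_{x'}([0,1])$,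 and $\mathcal I_x([0,1))\setminus\{x^*_{\max}\}=\mathcal I_{x'}([0,1))\setminus\{x^*_{\max}\}$. -/

import Mathlib

namespace Zeal

noncomputable section

/-! Double precision floating point numbers (as real numbers) and rounding to nearest. -/

/-- The finite double precision numbers: zero, subnormal and normal ones. A normal number
`(-1)^ν * 2^E * (1 + M * 2^(-52))`, with `-1022 ≤ E ≤ 1023` and `M < 2^52`, is `m * 2^e` with
`m = ± (2^52 + M)` and `e = E - 52`; subnormal numbers have `|m| < 2^52` and `e = -1074`. -/
def IsDouble (x : ℝ) : Prop :=
  ∃ m e : ℤ, |m| < 2 ^ 53 ∧ -1074 ≤ e ∧ e ≤ 971 ∧ x = (m : ℝ) * (2 : ℝ) ^ e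

/-- `fl` rounds every real number to a nearest finite double; ties are broken in any way
(in particular, ties to even is allowed). Overflow is not modelled. -/
def IsRoundToNearest (fl : ℝ → ℝ) : Prop :=
  ∀ z : ℝ, IsDouble (fl z) ∧ ∀ w : ℝ, IsDouble w → |z - fl z| ≤ |z - w|

/-- Rounding to nearest exists. -/
theorem exists_isRoundToNearest : ∃ fl : ℝ → ℝ, IsRoundToNearest fl := by
  have hfin : {x : ℝ | IsDouble x}.Finite := by
    refine ((Set.finite_Icc (-(2 ^ 53) : ℤ) (2 ^ 53)).prod
      (Set.finite_Icc (-1074 : ℤ) 971)).image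
        (fun q : ℤ × ℤ => (q.1 : ℝ) * (2 : ℝ) ^ q.2) |>.subset ?_
    rintro x ⟨m, e, hm, h1, h2, rfl⟩
    have := abs_lt.mp hm
    exact ⟨(m, e), ⟨⟨by omega, by omega⟩, ⟨h1, h2⟩⟩, rfl⟩
  have hne : {x : ℝ | IsDouble x}.Nonempty := ⟨0, 0, 0, by norm_num, by norm_num, by norm_num, by simp⟩
  have key : ∀ z : ℝ, ∃ y : ℝ, IsDouble y ∧ ∀ w : ℝ, IsDouble w → |z - y| ≤ |z - w| := fun z =>
    Set.exists_min_image _ (fun y => |z - y|) hfin hne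
  choose fl hfl using key
  exact ⟨fl, hfl⟩

/-- Unit in the last place of a number `x` with `2^E ≤ |x| < 2^(E+1)`, `-1022 ≤ E`. -/
def ulp (x : ℝ) : ℝ := (2 : ℝ) ^ (Int.log 2 |x| - 52)

/-! The piecewise mechanism on inputs in `[H - h, H + h]` with privacy budget `ε` and output
bias `A`. -/

/-- Half-width of the output range. -/
def C (h ε : ℝ) : ℝ := h * (Real.exp (ε / 2) + 1) / (Real.exp (ε / 2) - 1)

/-- The higher of the two levels of the density. -/
def p (h ε : ℝ) : ℝ :=
  (Real.exp ε - Real.exp (ε / 2)) / (2 * h * (Real.exp (ε / 2) + 1))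

/-- Smallest feasible output. -/
def xMin (H h ε A : ℝ) : ℝ := H - C h ε + A

/-- Largest feasible output. -/
def xMax (H h ε A : ℝ) : ℝ := H + C h ε + A

/-- Left end of the high part of the density for the input `x`. -/
def L (H h ε A x : ℝ) : ℝ :=
  (C h ε + h) / 2 * ((x - H) / h) - (C h ε - h) / 2 + H + A

/-- Right end of the high part of the density for the input `x`. -/
def R (H h ε A x : ℝ) : ℝ := L H h ε A x + C h ε - h

open Classical in
/-- Density of the output for the input `x`. -/
def pdf (H h ε A x t : ℝ) : ℝ :=
  if t ∈ Set.Icc (xMin H h ε A) (xMax H h ε A) then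
    if t ∈ Set.Icc (L H h ε A x) (R H h ε A x) then p h ε else p h ε / Real.exp ε
  else 0

/-- Cumulative distribution function of the output for the input `x`, at `z ≥ xMin`
(the density vanishes below `xMin`). -/
def cdf (H h ε A x z : ℝ) : ℝ := ∫ t in (xMin H h ε A)..z, pdf H h ε A x t

/-- Inverse of the cumulative distribution function on the output range. -/
def invCdf (H h ε A x q : ℝ) : ℝ :=
  sInf {z : ℝ | z ∈ Set.Icc (xMin H h ε A) (xMax H h ε A) ∧ q ≤ cdf H h ε A x z}

/-- The outputs that inverse-CDF sampling can produce on the input `x` when the cumulative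
probability is a double in `Q` and the result is rounded by `fl`. -/
def reachable (fl : ℝ → ℝ) (Q : Set ℝ) (H h ε A x : ℝ) : Set ℝ :=
  {y : ℝ | ∃ q : ℝ, IsDouble q ∧ q ∈ Q ∧ fl (invCdf H h ε A x q) = y}

/-! Choice of the bias. -/

/-- Unbiased exponent of the smallest exponent region that encloses the outputs. -/
def eEnc (h ε : ℝ) : ℤ := ⌈Real.logb 2 (2 * C h ε)⌉

/-- Smallest unbiased exponent that avoids the vulnerability. -/
def eVul (h ε : ℝ) : ℤ := max ⌈-1 + Real.logb 2 (Real.exp ε / p h ε)⌉ (eEnc h ε)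

/-- The bias aligned with the right end of the exponent region `[2^E, 2^(E+1))`. -/
def bias (H h ε : ℝ) (E : ℤ) : ℝ :=
  (2 : ℝ) ^ (E + 1) - 2 * ulp ((2 : ℝ) ^ E) - H - C h ε

end

end Zeal

namespace Zeal

open Set MeasureTheory

/-! Doubles and rounding -/

/-! A double `y` is output as soon as some double `q` lies strictly between the values of the CDF at
the ends of an interval around `y` that rounds to `y`; ties then play no role.

Above `2 ^ E` the doubles have spacing `u = 2 ^ (E - 52)`. The density is at least `low ≥ 2 ^ (-(E +
1))`, so such an interval has mass at least `2 ^ (-53)`, the spacing of the doubles in `[1/2, 1)`.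
Larger mass forces a double inside. If the mass is exactly `2 ^ (-53)`, the interval avoids the high
part: to its left the CDF is below `1 / 2`, where doubles are finer; to its right the CDF is affine,
and since `xMax` is a multiple of `u`, its value at `y` is itself a double
(`exists_isDouble_between_cdf`).

The range reaches at most `2 * u` below `2 ^ E`. The CDF there is so small that doubles are much
denser (`exists_isDouble_between_cdf_of_le`).

Rounding adds no output outside the range except possibly `fl xMin`, which every input produces from
`q = 0`. This determines the image without reference to the input. -/

lemma isDouble_zero : IsDouble 0 := ⟨0, 0, by norm_num, by norm_num, by norm_num, by simp⟩

lemma isDouble_one : IsDouble 1 := ⟨1, 0, by norm_num, by norm_num, by norm_num, by simp⟩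

/-- A double that is at least `2 ^ k` is an integral multiple of `2 ^ (k - 52)`. -/
lemma IsDouble.exists_eq_mul_zpow {w : ℝ} (hw : IsDouble w) {k : ℤ} (hk : (2 : ℝ) ^ k ≤ w) :
    ∃ n : ℤ, w = n * (2 : ℝ) ^ (k - 52) := by
  obtain ⟨m, e, hm, -, -, rfl⟩ := hw
  rcases le_or_gt (k - 52) e with h | h
  · obtain ⟨j, rfl⟩ : ∃ j : ℕ, e = k - 52 + j := ⟨(e - (k - 52)).toNat, by omega⟩
    refine ⟨m * 2 ^ j, ?_⟩
    rw [zpow_add₀ two_ne_zero]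
    push_cast
    rw [zpow_natCast]
    ring
  -- A smaller exponent would give `w < 2 ^ 53 * 2 ^ (k - 53) = 2 ^ k`.
  · exfalso
    have h1 : (m : ℝ) < 2 ^ 53 := by exact_mod_cast (abs_lt.mp hm).2
    have h2 : (2 : ℝ) ^ e ≤ 2 ^ (k - 53) := zpow_le_zpow_right₀ one_le_two (by omega)
    have h3 : (2 : ℝ) ^ k = 2 ^ 53 * 2 ^ (k - 53) := by
      rw [show k = (53 : ℕ) + (k - 53) by push_cast; ring, zpow_add₀ two_ne_zero, zpow_natCast]
      congr 2
      push_cast; ring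
    have h4 : (0 : ℝ) < 2 ^ e := by positivity
    nlinarith

/-- A number closer to the double `y` than half the spacing of the doubles near `y` is
rounded to `y`. -/
lemma IsRoundToNearest.eq_of_abs_lt {fl : ℝ → ℝ} (hfl : IsRoundToNearest fl) {y z : ℝ}
    (hy : IsDouble y) {k : ℤ} (hk : (2 : ℝ) ^ k + 2 ^ (k - 52) ≤ y)
    (hz : |z - y| < 2 ^ (k - 53)) : fl z = y := by
  obtain ⟨hw, hn⟩ := hfl z
  have hu : (2 : ℝ) ^ (k - 52) = 2 * 2 ^ (k - 53) := by
    rw [show k - 52 = 1 + (k - 53) by ring, zpow_add₀ two_ne_zero, zpow_one]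
  have hpos : (0 : ℝ) < 2 ^ (k - 52) := by positivity
  have hlt : |fl z - y| < 2 ^ (k - 52) := by
    have h1 : |fl z - y| ≤ |z - fl z| + |z - y| := by
      rw [abs_sub_comm z (fl z)]
      exact abs_sub_le _ _ _
    have h2 := hn y hy
    linarith
  -- The margin in `hk` keeps `fl z` where all doubles are multiples of `2 ^ (k - 52)`; two
  -- multiples less than one step apart coincide.
  have hge : (2 : ℝ) ^ k ≤ fl z := by
    have := (abs_lt.mp hlt).1
    linarith
  obtain ⟨n, hn⟩ := hw.exists_eq_mul_zpow hge
  obtain ⟨m, hm⟩ := hy.exists_eq_mul_zpow (k := k) (by linarith)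
  have h1 : |((n - m : ℤ) : ℝ)| < 1 := by
    rw [hn, hm, ← sub_mul, abs_mul, abs_of_pos hpos] at hlt
    push_cast
    nlinarith
  have h2 : |n - m| < 1 := by exact_mod_cast h1
  have h3 : n = m := by
    have := Int.abs_lt_one_iff.mp h2
    omega
  rw [hn, hm, h3]

lemma IsRoundToNearest.eq_self {fl : ℝ → ℝ} (hfl : IsRoundToNearest fl) {y : ℝ}
    (hy : IsDouble y) : fl y = y := by
  have := (hfl y).2 y hy
  rw [sub_self, abs_zero, abs_nonpos_iff, sub_eq_zero] at this
  exact this.symm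

lemma IsRoundToNearest.monotone {fl : ℝ → ℝ} (hfl : IsRoundToNearest fl) : Monotone fl := by
  intro z w hzw
  rcases hzw.eq_or_lt with rfl | hlt
  · exact le_rfl
  by_contra! h
  -- The two squared inequalities add up to `(w - z) * (fl z - fl w) ≤ 0`.
  have h1 := sq_le_sq.mpr ((hfl z).2 _ (hfl w).1)
  have h2 := sq_le_sq.mpr ((hfl w).2 _ (hfl z).1)
  nlinarith [mul_pos (sub_pos.mpr hlt) (sub_pos.mpr h)]

/-- Near zero the doubles are dense: an interval below `2 ^ (-j)` contains one as soon as it is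
longer than `2 ^ (-53 - j)`. -/
lemma exists_isDouble_between {a b : ℝ} {j : ℤ} (hj0 : 0 ≤ j) (hj : j ≤ 1000) (ha : 0 ≤ a)
    (hb : b ≤ 2 ^ (-j)) (hab : (2 : ℝ) ^ (-53 - j) < b - a) :
    ∃ q, IsDouble q ∧ a < q ∧ q < b := by
  set t : ℝ := 2 ^ (-53 - j) with ht
  have htpos : 0 < t := by positivity
  have h0 := Int.floor_le (a / t)
  have h1 := Int.lt_floor_add_one (a / t)
  rw [le_div_iff₀ htpos] at h0
  rw [div_lt_iff₀ htpos] at h1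
  have hlo : a < ((⌊a / t⌋ + 1 : ℤ) : ℝ) * t := by push_cast; exact h1
  have hhi : ((⌊a / t⌋ + 1 : ℤ) : ℝ) * t < b := by push_cast; linarith
  -- The first multiple of `t` beyond `a`; its factor fits in 53 bits because `2 ^ (-j) = 2 ^ 53 *
  -- t`.
  refine ⟨_, ⟨⌊a / t⌋ + 1, -53 - j, ?_, by omega, by omega, rfl⟩, hlo, hhi⟩
  have hnn : 0 ≤ ⌊a / t⌋ := Int.floor_nonneg.mpr (by positivity)
  rw [abs_of_nonneg (by omega)]
  have h2 : (2 : ℝ) ^ (-j) = 2 ^ 53 * t := by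
    rw [ht, show -j = (53 : ℕ) + (-53 - j) by push_cast; ring, zpow_add₀ two_ne_zero,
      zpow_natCast]
  have h3 : ((⌊a / t⌋ + 1 : ℤ) : ℝ) < 2 ^ 53 := by
    refine lt_of_mul_lt_mul_right ?_ htpos.le
    linarith
  exact_mod_cast h3

/-! The mechanism -/

section Mechanism

variable {H h ε A x : ℝ}

lemma one_lt_exp_half (hε : 0 < ε) : 1 < Real.exp (ε / 2) := Real.one_lt_exp_iff.mpr (by linarith)

lemma exp_eq_sq (ε : ℝ) : Real.exp ε = Real.exp (ε / 2) ^ 2 := by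
  rw [← Real.exp_nat_mul]; congr 1; push_cast; ring

lemma C_pos (hh : 0 < h) (hε : 0 < ε) : 0 < C h ε := by
  have := one_lt_exp_half hε
  exact div_pos (by positivity) (by linarith)

lemma C_mul (hε : 0 < ε) : C h ε * (Real.exp (ε / 2) - 1) = h * (Real.exp (ε / 2) + 1) := by
  have := one_lt_exp_half hε
  exact div_mul_cancel₀ _ (by linarith)

lemma p_mul (hh : 0 < h) (hε : 0 < ε) : p h ε * (2 * C h ε) = Real.exp (ε / 2) := by
  have := one_lt_exp_half hε
  have h1 : Real.exp (ε / 2) - 1 ≠ 0 := by linarith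
  have h2 : Real.exp (ε / 2) + 1 ≠ 0 := by linarith
  rw [p, C, exp_eq_sq]
  field_simp

lemma p_pos (hh : 0 < h) (hε : 0 < ε) : 0 < p h ε :=
  pos_of_mul_pos_left (by rw [p_mul hh hε]; positivity) (by linarith [C_pos hh hε])

/-- The lower of the two levels of the density. -/
noncomputable def low (h ε : ℝ) : ℝ := p h ε / Real.exp ε

lemma low_pos (hh : 0 < h) (hε : 0 < ε) : 0 < low h ε := div_pos (p_pos hh hε) (Real.exp_pos _)

lemma low_lt_p (hh : 0 < h) (hε : 0 < ε) : low h ε < p h ε :=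
  div_lt_self (p_pos hh hε) (Real.one_lt_exp_iff.mpr hε)

lemma low_mul (hh : 0 < h) (hε : 0 < ε) :
    low h ε * (2 * C h ε) * Real.exp (ε / 2) = 1 := by
  have h1 := p_mul hh hε
  have h2 := Real.exp_pos (ε / 2)
  rw [low, exp_eq_sq]
  field_simp
  linarith

lemma lt_C (hh : 0 < h) (hε : 0 < ε) : h < C h ε := by
  have h1 := one_lt_exp_half hε
  have h2 := C_mul (h := h) hε
  nlinarith

lemma xMin_le_L (hh : 0 < h) (hε : 0 < ε) (hx : x ∈ Icc (H - h) (H + h)) :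
    xMin H h ε A ≤ L H h ε A x := by
  have h1 : -1 ≤ (x - H) / h := by rw [le_div_iff₀ hh]; linarith [hx.1]
  have := C_pos hh hε
  unfold xMin L
  nlinarith

lemma R_le_xMax (hh : 0 < h) (hε : 0 < ε) (hx : x ∈ Icc (H - h) (H + h)) :
    R H h ε A x ≤ xMax H h ε A := by
  have h1 : (x - H) / h ≤ 1 := by rw [div_le_iff₀ hh]; linarith [hx.2]
  have := C_pos hh hε
  unfold xMax R L
  nlinarith

lemma L_lt_R (hh : 0 < h) (hε : 0 < ε) : L H h ε A x < R H h ε A x := by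
  have := lt_C hh hε
  unfold R
  linarith

/-- The cumulative distribution function in closed form. -/
lemma cdf_eq (hh : 0 < h) (hε : 0 < ε) (hx : x ∈ Icc (H - h) (H + h)) {z : ℝ}
    (hz : z ∈ Icc (xMin H h ε A) (xMax H h ε A)) :
    cdf H h ε A x z = low h ε * (z - xMin H h ε A) +
      (p h ε - low h ε) * max (min z (R H h ε A x) - L H h ε A x) 0 := by
  have hL := xMin_le_L (A := A) hh hε hx
  -- The density is a constant plus a bump on `[L, R]`; the max-min term is the length of the bump
  -- covered so far.
  have hpt : ∀ t ∈ Icc (xMin H h ε A) z, pdf H h ε A x t = low h ε +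
      (Icc (L H h ε A x) (R H h ε A x)).indicator (fun _ => p h ε - low h ε) t := by
    intro t ht
    rw [pdf, if_pos ⟨ht.1, ht.2.trans hz.2⟩]
    by_cases hm : t ∈ Icc (L H h ε A x) (R H h ε A x)
    · rw [if_pos hm, indicator_of_mem hm]; ring
    · rw [if_neg hm, indicator_of_notMem hm, low]; ring
  have : IsFiniteMeasure (volume.restrict (Icc (xMin H h ε A) z)) := ⟨by simp⟩
  rw [cdf, intervalIntegral.integral_of_le hz.1, ← integral_Icc_eq_integral_Ioc,
    setIntegral_congr_fun measurableSet_Icc hpt, integral_add (integrable_const _)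
      ((integrable_const _).indicator measurableSet_Icc),
    setIntegral_indicator measurableSet_Icc, setIntegral_const, setIntegral_const,
    Icc_inter_Icc, Measure.real, Real.volume_Icc, Measure.real, Real.volume_Icc,
    ENNReal.toReal_ofReal (sub_nonneg.mpr hz.1), ENNReal.toReal_ofReal']
  simp only [smul_eq_mul, max_eq_right hL, min_comm z]
  ring_nf

lemma cdf_sub_ge (hh : 0 < h) (hε : 0 < ε) (hx : x ∈ Icc (H - h) (H + h)) {z w : ℝ}
    (hz : z ∈ Icc (xMin H h ε A) (xMax H h ε A)) (hw : w ∈ Icc (xMin H h ε A) (xMax H h ε A))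
    (hzw : z ≤ w) : low h ε * (w - z) ≤ cdf H h ε A x w - cdf H h ε A x z := by
  rw [cdf_eq hh hε hx hz, cdf_eq hh hε hx hw]
  have h1 := low_lt_p hh hε
  have h2 : max (min z (R H h ε A x) - L H h ε A x) 0 ≤
      max (min w (R H h ε A x) - L H h ε A x) 0 := by gcongr
  nlinarith

lemma cdf_le (hh : 0 < h) (hε : 0 < ε) (hx : x ∈ Icc (H - h) (H + h)) {z : ℝ}
    (hz : z ∈ Icc (xMin H h ε A) (xMax H h ε A)) :
    cdf H h ε A x z ≤ p h ε * (z - xMin H h ε A) := by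
  rw [cdf_eq hh hε hx hz]
  have h1 := low_lt_p hh hε
  have hL := xMin_le_L (A := A) hh hε hx
  have h2 : max (min z (R H h ε A x) - L H h ε A x) 0 ≤ z - xMin H h ε A :=
    max_le (by linarith [min_le_left z (R H h ε A x)]) (by linarith [hz.1])
  nlinarith

lemma cdf_strictMonoOn (hh : 0 < h) (hε : 0 < ε) (hx : x ∈ Icc (H - h) (H + h)) :
    StrictMonoOn (cdf H h ε A x) (Icc (xMin H h ε A) (xMax H h ε A)) := by
  intro z hz w hw hzw
  have h1 := cdf_sub_ge hh hε hx hz hw hzw.le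
  have h2 := mul_pos (low_pos hh hε) (sub_pos.mpr hzw)
  linarith

lemma cdf_continuousOn (hh : 0 < h) (hε : 0 < ε) (hx : x ∈ Icc (H - h) (H + h)) :
    ContinuousOn (cdf H h ε A x) (Icc (xMin H h ε A) (xMax H h ε A)) := by
  refine ContinuousOn.congr (Continuous.continuousOn ?_) fun z hz => cdf_eq hh hε hx hz
  fun_prop

lemma cdf_xMin : cdf H h ε A x (xMin H h ε A) = 0 := intervalIntegral.integral_same

lemma xMin_le_xMax (hh : 0 < h) (hε : 0 < ε) : xMin H h ε A ≤ xMax H h ε A := by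
  have := C_pos hh hε
  unfold xMin xMax
  linarith

lemma cdf_xMax (hh : 0 < h) (hε : 0 < ε) (hx : x ∈ Icc (H - h) (H + h)) :
    cdf H h ε A x (xMax H h ε A) = 1 := by
  have hLR := L_lt_R (H := H) (A := A) (x := x) hh hε
  rw [cdf_eq hh hε hx (right_mem_Icc.mpr (xMin_le_xMax hh hε)),
    min_eq_right (R_le_xMax hh hε hx), max_eq_left (by linarith)]
  have h1 := one_lt_exp_half hε
  have h2 : Real.exp (ε / 2) - 1 ≠ 0 := by linarith
  have h3 : Real.exp (ε / 2) + 1 ≠ 0 := by linarith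
  have h4 := Real.exp_pos (ε / 2)
  simp only [R, xMax, xMin, low, p, C]
  rw [exp_eq_sq ε]
  field_simp
  ring

lemma cdf_nonneg (hh : 0 < h) (hε : 0 < ε) (hx : x ∈ Icc (H - h) (H + h)) {z : ℝ}
    (hz : z ∈ Icc (xMin H h ε A) (xMax H h ε A)) : 0 ≤ cdf H h ε A x z := by
  rw [← cdf_xMin (H := H) (h := h) (ε := ε) (A := A) (x := x)]
  exact (cdf_strictMonoOn hh hε hx).monotoneOn
    (left_mem_Icc.mpr (xMin_le_xMax hh hε)) hz hz.1

lemma cdf_le_one (hh : 0 < h) (hε : 0 < ε) (hx : x ∈ Icc (H - h) (H + h)) {z : ℝ}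
    (hz : z ∈ Icc (xMin H h ε A) (xMax H h ε A)) : cdf H h ε A x z ≤ 1 := by
  rw [← cdf_xMax (A := A) hh hε hx]
  exact (cdf_strictMonoOn hh hε hx).monotoneOn hz
    (right_mem_Icc.mpr (xMin_le_xMax hh hε)) hz.2

lemma invCdf_cdf (hh : 0 < h) (hε : 0 < ε) (hx : x ∈ Icc (H - h) (H + h)) {z : ℝ}
    (hz : z ∈ Icc (xMin H h ε A) (xMax H h ε A)) :
    invCdf H h ε A x (cdf H h ε A x z) = z := by
  refine IsLeast.csInf_eq ⟨⟨hz, le_rfl⟩, fun w hw => ?_⟩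
  exact (cdf_strictMonoOn hh hε hx).le_iff_le hz hw.1 |>.mp hw.2

lemma invCdf_zero (hh : 0 < h) (hε : 0 < ε) (hx : x ∈ Icc (H - h) (H + h)) :
    invCdf H h ε A x 0 = xMin H h ε A := by
  have := invCdf_cdf (A := A) hh hε hx (left_mem_Icc.mpr (xMin_le_xMax hh hε))
  rwa [cdf_xMin] at this

lemma invCdf_one (hh : 0 < h) (hε : 0 < ε) (hx : x ∈ Icc (H - h) (H + h)) :
    invCdf H h ε A x 1 = xMax H h ε A := by
  have := invCdf_cdf (A := A) hh hε hx (right_mem_Icc.mpr (xMin_le_xMax hh hε))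
  rwa [cdf_xMax hh hε hx] at this

lemma invCdf_mem_Ioo (hh : 0 < h) (hε : 0 < ε) (hx : x ∈ Icc (H - h) (H + h)) {a b q : ℝ}
    (ha : xMin H h ε A ≤ a) (hab : a ≤ b) (hb : b ≤ xMax H h ε A)
    (hq : q ∈ Ioo (cdf H h ε A x a) (cdf H h ε A x b)) : invCdf H h ε A x q ∈ Ioo a b := by
  obtain ⟨z, hz, rfl⟩ := intermediate_value_Ioo hab
    ((cdf_continuousOn hh hε hx).mono (Icc_subset_Icc ha hb)) hq
  rwa [invCdf_cdf hh hε hx ⟨ha.trans hz.1.le, hz.2.le.trans hb⟩]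

lemma invCdf_mem_Icc (hh : 0 < h) (hε : 0 < ε) (hx : x ∈ Icc (H - h) (H + h)) {q : ℝ}
    (hq : q ∈ Icc (0 : ℝ) 1) : invCdf H h ε A x q ∈ Icc (xMin H h ε A) (xMax H h ε A) := by
  have hle := xMin_le_xMax (H := H) (A := A) hh hε
  rw [← cdf_xMin (H := H) (h := h) (ε := ε) (A := A) (x := x), ← cdf_xMax (A := A) hh hε hx] at hq
  obtain ⟨z, hz, rfl⟩ := intermediate_value_Icc hle (cdf_continuousOn hh hε hx) hq
  rwa [invCdf_cdf hh hε hx hz]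

/-- The low part of the density carries less than half of the mass. -/
lemma cdf_lt_half (hh : 0 < h) (hε : 0 < ε) (hx : x ∈ Icc (H - h) (H + h)) {z : ℝ}
    (hz : z ∈ Icc (xMin H h ε A) (xMax H h ε A)) (hzL : z ≤ L H h ε A x) :
    cdf H h ε A x z < 1 / 2 := by
  rw [cdf_eq hh hε hx hz, max_eq_right (by linarith [min_le_left z (R H h ε A x)])]
  have h1 := one_lt_exp_half hε
  have h2 := low_mul hh hε
  have h3 := C_mul (h := h) hε
  have h4 := R_le_xMax (A := A) hh hε hx
  have h5 := low_pos hh hε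
  have h6 : z - xMin H h ε A ≤ C h ε + h := by
    unfold R xMax at h4
    unfold xMin
    linarith
  -- With `s = exp (ε / 2)`, the definition of `C` gives `(C + h) * (s + 1) = 2 * C * s`, so all low
  -- mass together is `1 / (s + 1) < 1 / 2`.
  have h7 : low h ε * (C h ε + h) * (Real.exp (ε / 2) + 1) = 1 := by
    linear_combination h2 - low h ε * h3
  have h8 : 0 < low h ε * (C h ε + h) := by have := C_pos hh hε; positivity
  nlinarith

/-- Right of the high part the cumulative distribution function is affine. -/
lemma cdf_of_R_le (hh : 0 < h) (hε : 0 < ε) (hx : x ∈ Icc (H - h) (H + h)) {z : ℝ}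
    (hz : z ∈ Icc (xMin H h ε A) (xMax H h ε A)) (hRz : R H h ε A x ≤ z) :
    cdf H h ε A x z = 1 - low h ε * (xMax H h ε A - z) := by
  rw [← cdf_xMax (A := A) hh hε hx, cdf_eq hh hε hx hz,
    cdf_eq hh hε hx (right_mem_Icc.mpr (xMin_le_xMax hh hε)), min_eq_right hRz,
    min_eq_right (R_le_xMax hh hε hx)]
  ring

/-- An interval that meets the high part has more mass than at the low level. -/
lemma cdf_sub_gt (hh : 0 < h) (hε : 0 < ε) (hx : x ∈ Icc (H - h) (H + h)) {z w : ℝ}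
    (hz : z ∈ Icc (xMin H h ε A) (xMax H h ε A)) (hw : w ∈ Icc (xMin H h ε A) (xMax H h ε A))
    (hzw : z < w) (hL : L H h ε A x < w) (hR : z < R H h ε A x) :
    low h ε * (w - z) < cdf H h ε A x w - cdf H h ε A x z := by
  rw [cdf_eq hh hε hx hz, cdf_eq hh hε hx hw]
  have h1 := low_lt_p hh hε
  have hLR := L_lt_R (H := H) (A := A) (x := x) hh hε
  have h2 : max (min z (R H h ε A x) - L H h ε A x) 0 <
      max (min w (R H h ε A x) - L H h ε A x) 0 := by
    rw [min_eq_left hR.le]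
    refine lt_max_of_lt_left (max_lt ?_ ?_)
    · exact sub_lt_sub_right (lt_min hzw hR) _
    · exact sub_pos.mpr (lt_min hL hLR)
  nlinarith

end Mechanism


/-! ### Consequences of the bias: alignment, and masses of rounding intervals -/

section Bias

variable {H h ε A x : ℝ} {E : ℤ}

lemma two_C_le (hh : 0 < h) (hε : 0 < ε) (hE : eVul h ε ≤ E) : 2 * C h ε ≤ (2 : ℝ) ^ E := by
  have hC := C_pos hh hε
  have h1 : Real.logb 2 (2 * C h ε) ≤ (E : ℝ) :=
    Int.ceil_le.mp ((le_max_right _ _).trans hE)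
  rwa [Real.logb_le_iff_le_rpow one_lt_two (by positivity), Real.rpow_intCast] at h1

lemma one_le_low_mul (hh : 0 < h) (hε : 0 < ε) (hE : eVul h ε ≤ E) :
    1 ≤ low h ε * (2 : ℝ) ^ (E + 1) := by
  have hp := p_pos hh hε
  have he := Real.exp_pos ε
  have h1 : -1 + Real.logb 2 (Real.exp ε / p h ε) ≤ (E : ℝ) :=
    Int.ceil_le.mp ((le_max_left _ _).trans hE)
  have h2 : Real.logb 2 (Real.exp ε / p h ε) ≤ ((E + 1 : ℤ) : ℝ) := by push_cast; linarith
  rw [Real.logb_le_iff_le_rpow one_lt_two (by positivity), Real.rpow_intCast,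
    div_le_iff₀ hp] at h2
  rw [low, div_mul_eq_mul_div, one_le_div he]
  linarith

lemma xMax_bias (hA : A = bias H h ε E) :
    xMax H h ε A = (2 : ℝ) ^ (E + 1) - 2 * 2 ^ (E - 52) := by
  have h1 : Int.log 2 |(2 : ℝ) ^ E| = E := by
    rw [abs_of_pos (by positivity)]
    exact_mod_cast Int.log_zpow (R := ℝ) one_lt_two E
  rw [xMax, hA, bias, ulp, h1]
  ring

lemma xMax_bias_eq_mul (hA : A = bias H h ε E) :
    xMax H h ε A = ((2 ^ 53 - 2 : ℤ) : ℝ) * 2 ^ (E - 52) := by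
  rw [xMax_bias hA, show E + 1 = 53 + (E - 52) by ring, zpow_add₀ two_ne_zero]
  push_cast
  norm_num
  ring

lemma isDouble_xMax (hE_min : -1022 < E) (hE_max : E ≤ 1023) (hA : A = bias H h ε E) :
    IsDouble (xMax H h ε A) :=
  ⟨2 ^ 53 - 2, E - 52, by norm_num, by omega, by omega, xMax_bias_eq_mul hA⟩

lemma le_xMin (hh : 0 < h) (hε : 0 < ε) (hE : eVul h ε ≤ E) (hA : A = bias H h ε E) :
    (2 : ℝ) ^ E - 2 * 2 ^ (E - 52) ≤ xMin H h ε A := by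
  have h1 := two_C_le hh hε hE
  have h2 := xMax_bias hA
  rw [zpow_add_one₀ two_ne_zero] at h2
  have h3 : xMin H h ε A = xMax H h ε A - 2 * C h ε := by unfold xMin xMax; ring
  linarith

/-- If the neighbourhood of radius `r` of a point `y` is rounded to `y`, and the doubles
hit the image of this neighbourhood, then `y` is reachable. -/
lemma mem_reachable_of_radius (hh : 0 < h) (hε : 0 < ε) (hx : x ∈ Icc (H - h) (H + h))
    {fl : ℝ → ℝ} {y r : ℝ} (hr : 0 < r) (hfl : ∀ z, |z - y| < r → fl z = y)
    (hy : xMin H h ε A ≤ y) (hyr : y + r ≤ xMax H h ε A)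
    (hq : xMin H h ε A ≤ y - r →
      ∃ q, IsDouble q ∧ cdf H h ε A x (y - r) < q ∧ q < cdf H h ε A x (y + r)) :
    y ∈ reachable fl (Ico 0 1) H h ε A x := by
  rcases lt_or_ge (y - r) (xMin H h ε A) with h1 | h1
  -- The neighbourhood sticks out on the left, so `xMin`, the value at `q = 0`, is within `r` of
  -- `y`.
  · refine ⟨0, isDouble_zero, by simp, hfl _ ?_⟩
    rw [invCdf_zero hh hε hx, abs_lt]
    constructor <;> linarith
  · obtain ⟨q, hqd, hlo, hhi⟩ := hq h1
    have h2 := invCdf_mem_Ioo hh hε hx h1 (by linarith) hyr ⟨hlo, hhi⟩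
    refine ⟨q, hqd, ⟨?_, ?_⟩, hfl _ ?_⟩
    · exact (cdf_nonneg hh hε hx ⟨h1, by linarith⟩).trans hlo.le
    · exact hhi.trans_le (cdf_le_one hh hε hx ⟨by linarith, hyr⟩)
    · rw [abs_lt]
      constructor <;> linarith [h2.1, h2.2]

/-- Above `2 ^ E` the image of the neighbourhood of a double `y` contains a double. -/
lemma exists_isDouble_between_cdf (hh : 0 < h) (hε : 0 < ε) (hE : eVul h ε ≤ E)
    (hA : A = bias H h ε E) (hx : x ∈ Icc (H - h) (H + h)) {y : ℝ} (hy : IsDouble y)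
    (hEy : (2 : ℝ) ^ E ≤ y) (hlo : xMin H h ε A ≤ y - 2 ^ (E - 53))
    (hhi : y + 2 ^ (E - 53) ≤ xMax H h ε A) :
    ∃ q, IsDouble q ∧ cdf H h ε A x (y - 2 ^ (E - 53)) < q ∧
      q < cdf H h ε A x (y + 2 ^ (E - 53)) := by
  set r : ℝ := 2 ^ (E - 53) with hr
  have hr0 : 0 < r := by positivity
  have hlow := one_le_low_mul hh hε hE
  have hmemlo : y - r ∈ Icc (xMin H h ε A) (xMax H h ε A) := ⟨hlo, by linarith⟩
  have hmemhi : y + r ∈ Icc (xMin H h ε A) (xMax H h ε A) := ⟨by linarith, hhi⟩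
  have hmem : y ∈ Icc (xMin H h ε A) (xMax H h ε A) := ⟨by linarith, by linarith⟩
  have h2r : (2 : ℝ) ^ (E + 1) = 2 ^ 53 * (2 * r) := by
    rw [hr, show E + 1 = 53 + (1 + (E - 53)) by ring, zpow_add₀ two_ne_zero,
      zpow_add₀ two_ne_zero]
    norm_num
  have hu : (2 : ℝ) ^ (E - 52) = 2 * r := by
    rw [hr, show E - 52 = 1 + (E - 53) by ring, zpow_add₀ two_ne_zero, zpow_one]
  have hc53 : (2 : ℝ) ^ (-53 : ℤ) * 2 ^ 53 = 1 := by norm_num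
  have hlow2r : (2 : ℝ) ^ (-53 : ℤ) ≤ low h ε * (2 * r) := by
    rw [h2r] at hlow
    linarith
  have hge := cdf_sub_ge hh hε hx hmemlo hmemhi (by linarith)
  rw [show y + r - (y - r) = 2 * r by ring] at hge
  have hnn := cdf_nonneg hh hε hx hmemlo
  have hone := cdf_le_one hh hε hx hmemhi
  by_cases hstrict :
      (2 : ℝ) ^ (-53 : ℤ) < cdf H h ε A x (y + r) - cdf H h ε A x (y - r)
  · exact exists_isDouble_between (j := 0) le_rfl (by norm_num) hnn (by simpa using hone)
      (by simpa using hstrict)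
  -- In the tight case no mass exceeds the low level, so the interval cannot meet the interior of
  -- `[L, R]`.
  have heq : low h ε * (2 * r) = 2 ^ (-53 : ℤ) := by linarith
  rcases le_or_gt (y + r) (L H h ε A x) with hL | hL
  · have := cdf_lt_half hh hε hx hmemhi hL
    refine exists_isDouble_between (j := 1) (by norm_num) (by norm_num) hnn ?_ ?_
    · norm_num
      linarith
    · calc (2 : ℝ) ^ (-53 - 1 : ℤ) < 2 ^ (-53 : ℤ) :=
            zpow_lt_zpow_right₀ one_lt_two (by norm_num)
        _ ≤ _ := by linarith
  · have hR : R H h ε A x ≤ y - r := by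
      by_contra! hR
      have := cdf_sub_gt hh hε hx hmemlo hmemhi (by linarith) hL hR
      rw [show y + r - (y - r) = 2 * r by ring] at this
      linarith
    have hmono := cdf_strictMonoOn (A := A) hh hε hx
    refine ⟨cdf H h ε A x y, ?_, hmono hmemlo hmem (by linarith),
      hmono hmem hmemhi (by linarith)⟩
    obtain ⟨n, hn⟩ := hy.exists_eq_mul_zpow hEy
    -- Here `low * u = 2 ^ (-53)` and `xMax - y = (2 ^ 53 - 2 - n) * u`.
    have hval : cdf H h ε A x y = ((n + 2 : ℤ) : ℝ) * 2 ^ (-53 : ℤ) := by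
      rw [cdf_of_R_le hh hε hx hmem (by linarith), xMax_bias_eq_mul hA, hn, hu, ← heq]
      push_cast
      linear_combination (-(2 ^ 53 : ℝ)) * heq - hc53
    have hlt : cdf H h ε A x y < 1 :=
      (hmono hmem hmemhi (by linarith)).trans_le hone
    have hnn' := cdf_nonneg hh hε hx hmem
    rw [hval] at hlt hnn'
    have hpos : (0 : ℝ) < 2 ^ (-53 : ℤ) := by positivity
    refine ⟨n + 2, -53, ?_, by norm_num, by norm_num, hval⟩
    have h1 : 0 ≤ n + 2 := by
      have := nonneg_of_mul_nonneg_left hnn' hpos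
      exact_mod_cast this
    rw [abs_of_nonneg h1]
    have h2 : ((n + 2 : ℤ) : ℝ) < 2 ^ 53 := by
      refine lt_of_mul_lt_mul_right ?_ hpos.le
      linarith
    exact_mod_cast h2

/-- Below `2 ^ E` the cumulative probabilities are tiny, hence the doubles are dense there. -/
lemma exists_isDouble_between_cdf_of_le (hh : 0 < h) (hε : 0 < ε) (hE : eVul h ε ≤ E)
    (hA : A = bias H h ε E) (hx : x ∈ Icc (H - h) (H + h)) {y : ℝ}
    (hyE : y ≤ (2 : ℝ) ^ E) (hlo : xMin H h ε A ≤ y - 2 ^ (E - 54))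
    (hhi : y + 2 ^ (E - 54) ≤ xMax H h ε A) :
    ∃ q, IsDouble q ∧ cdf H h ε A x (y - 2 ^ (E - 54)) < q ∧
      q < cdf H h ε A x (y + 2 ^ (E - 54)) := by
  have hxMin := le_xMin hh hε hE hA
  have hxMax := xMax_bias hA
  set r : ℝ := 2 ^ (E - 54) with hr
  have hr0 : 0 < r := by positivity
  have hlow := one_le_low_mul hh hε hE
  have hEr : (2 : ℝ) ^ E = 2 ^ 54 * r := by
    rw [hr, show E = 54 + (E - 54) by ring, zpow_add₀ two_ne_zero]
    norm_num
  have hu : (2 : ℝ) ^ (E - 52) = 4 * r := by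
    rw [hr, show E - 52 = 2 + (E - 54) by ring, zpow_add₀ two_ne_zero]
    norm_num
  rw [zpow_add_one₀ two_ne_zero, hEr] at hlow hxMax
  rw [hEr, hu] at hxMin
  rw [hu] at hxMax
  have hmemlo : y - r ∈ Icc (xMin H h ε A) (xMax H h ε A) := ⟨hlo, by linarith⟩
  have hmemhi : y + r ∈ Icc (xMin H h ε A) (xMax H h ε A) := ⟨by linarith, hhi⟩
  have hge := cdf_sub_ge hh hε hx hmemlo hmemhi (by linarith)
  have hle := cdf_le hh hε hx hmemhi
  have hC : 2 * C h ε = xMax H h ε A - xMin H h ε A := by unfold xMin xMax; ring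
  -- Since `xMin < 2 ^ E`, the range is longer than `2 ^ E - 2 * u`, hence than `2 ^ E / 2 = 2 ^ 53
  -- * r`.
  have hCr : 2 ^ 53 * r ≤ 2 * C h ε := by linarith
  have hp := p_pos hh hε
  have hl := low_pos hh hε
  have h1 := p_mul hh hε
  have h2 := low_mul hh hε
  have hs := one_lt_exp_half hε
  -- the high level is at most `8 / 2 ^ E`
  have hs4 : Real.exp (ε / 2) ≤ 4 := by
    have h3 : low h ε * (2 ^ 53 * r) * Real.exp (ε / 2) ≤ 1 := by
      rw [← h2]; gcongr
    nlinarith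
  have hpr : p h ε * (2 ^ 53 * r) ≤ 4 := by
    calc p h ε * (2 ^ 53 * r) ≤ p h ε * (2 * C h ε) := by gcongr
      _ ≤ 4 := by linarith
  have hsmall : y + r - xMin H h ε A ≤ 9 * r := by linarith
  have hbound : cdf H h ε A x (y + r) ≤ p h ε * (9 * r) :=
    hle.trans (by gcongr)
  -- The CDF is at most `9 * p * r ≤ 36 * 2 ^ (-53)`, far below `2 ^ (-5)`, while the mass is at
  -- least `2 * r * low ≥ 2 ^ (-54)`.
  refine exists_isDouble_between (j := 5) (by norm_num) (by norm_num)
    (cdf_nonneg hh hε hx hmemlo) ?_ ?_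
  · norm_num
    linarith
  · norm_num
    linarith

/-! ### The set of outputs -/

lemma Ico_subset_reachable (hh : 0 < h) (hε : 0 < ε) (hE : eVul h ε ≤ E)
    (hA : A = bias H h ε E) {fl : ℝ → ℝ} (hfl : IsRoundToNearest fl)
    (hx : x ∈ Icc (H - h) (H + h)) {y : ℝ} (hy : IsDouble y)
    (hmem : y ∈ Ico (xMin H h ε A) (xMax H h ε A)) :
    y ∈ reachable fl (Ico 0 1) H h ε A x := by
  have hxMin := le_xMin hh hε hE hA
  have hxMax := xMax_bias_eq_mul hA
  have hEu : (2 : ℝ) ^ E = 2 ^ 52 * 2 ^ (E - 52) := by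
    conv_lhs => rw [show E = 52 + (E - 52) by ring, zpow_add₀ two_ne_zero]
    norm_num
  have hu0 : (0 : ℝ) < 2 ^ (E - 52) := by positivity
  have hu1 : (2 : ℝ) ^ (E - 52) = 2 * 2 ^ (E - 53) := by
    rw [show E - 52 = 1 + (E - 53) by ring, zpow_add₀ two_ne_zero, zpow_one]
  have hu2 : (2 : ℝ) ^ (E - 53) = 2 * 2 ^ (E - 54) := by
    rw [show E - 53 = 1 + (E - 54) by ring, zpow_add₀ two_ne_zero, zpow_one]
  rcases lt_or_ge ((2 : ℝ) ^ E) y with hlt | hge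
  · obtain ⟨n, hn⟩ := hy.exists_eq_mul_zpow hlt.le
    have h1 : (2 : ℝ) ^ E + 2 ^ (E - 52) ≤ y := by
      rw [hn, hEu] at hlt
      have h2 : ((2 ^ 52 : ℤ) : ℝ) < n := by
        refine lt_of_mul_lt_mul_right ?_ hu0.le
        exact_mod_cast hlt
      have h3 : ((2 ^ 52 : ℤ) : ℝ) + 1 ≤ n := by exact_mod_cast h2
      push_cast at h3
      rw [hn, hEu]
      nlinarith
    have h4 : y + 2 ^ (E - 52) ≤ xMax H h ε A := by
      have h2 := hmem.2
      rw [hn, hxMax] at h2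
      have h5 : (n : ℝ) + 1 ≤ ((2 ^ 53 - 2 : ℤ) : ℝ) := by
        have := lt_of_mul_lt_mul_right h2 hu0.le
        exact_mod_cast this
      rw [hn, hxMax]
      nlinarith
    have h5 : y + 2 ^ (E - 53) ≤ xMax H h ε A := by linarith
    exact mem_reachable_of_radius hh hε hx (by positivity)
      (fun z hz => hfl.eq_of_abs_lt hy h1 hz) hmem.1 h5
      fun h6 => exists_isDouble_between_cdf hh hε hE hA hx hy hlt.le h6 h5
  -- The point `2 ^ E` belongs here: the spacing halves below it, so the exponent `E - 1` and half
  -- the radius are used.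
  · have hE1 : (2 : ℝ) ^ E = 2 * 2 ^ (E - 1) := by
      conv_lhs => rw [show E = 1 + (E - 1) by ring, zpow_add₀ two_ne_zero, zpow_one]
    have h1 : (2 : ℝ) ^ (E - 1) + 2 ^ (E - 1 - 52) ≤ y := by
      rw [show E - 1 - 52 = E - 53 by ring]
      linarith [hmem.1]
    have h5 : y + 2 ^ (E - 54) ≤ xMax H h ε A := by
      rw [hxMax]
      push_cast
      linarith
    refine mem_reachable_of_radius hh hε hx (by positivity)
      (fun z hz => hfl.eq_of_abs_lt hy h1 ?_) hmem.1 h5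
      fun h6 => exists_isDouble_between_cdf_of_le hh hε hE hA hx hge h6 h5
    rwa [show E - 1 - 53 = E - 54 by ring]

lemma reachable_mono (fl : ℝ → ℝ) {Q Q' : Set ℝ} (hQ : Q ⊆ Q') :
    reachable fl Q H h ε A x ⊆ reachable fl Q' H h ε A x := by
  rintro y ⟨q, hq, hmem, rfl⟩
  exact ⟨q, hq, hQ hmem, rfl⟩

lemma xMax_mem_reachable (hh : 0 < h) (hε : 0 < ε) (hE_min : -1022 < E) (hE_max : E ≤ 1023)
    (hA : A = bias H h ε E) {fl : ℝ → ℝ} (hfl : IsRoundToNearest fl)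
    (hx : x ∈ Icc (H - h) (H + h)) :
    xMax H h ε A ∈ reachable fl (Icc 0 1) H h ε A x := by
  refine ⟨1, isDouble_one, by simp, ?_⟩
  rw [invCdf_one hh hε hx, hfl.eq_self (isDouble_xMax hE_min hE_max hA)]

lemma fl_xMin_mem_reachable (hh : 0 < h) (hε : 0 < ε) (fl : ℝ → ℝ)
    (hx : x ∈ Icc (H - h) (H + h)) :
    fl (xMin H h ε A) ∈ reachable fl (Ico 0 1) H h ε A x :=
  ⟨0, isDouble_zero, by simp, by rw [invCdf_zero hh hε hx]⟩

/-- Every output is a double of the output range, or the rounded left end of this range. -/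
lemma of_mem_reachable (hh : 0 < h) (hε : 0 < ε) (hE_min : -1022 < E) (hE_max : E ≤ 1023)
    (hA : A = bias H h ε E) {fl : ℝ → ℝ} (hfl : IsRoundToNearest fl)
    (hx : x ∈ Icc (H - h) (H + h)) {y : ℝ} (hy : y ∈ reachable fl (Icc 0 1) H h ε A x) :
    (IsDouble y ∧ y ∈ Icc (xMin H h ε A) (xMax H h ε A)) ∨ y = fl (xMin H h ε A) := by
  obtain ⟨q, -, hq, rfl⟩ := hy
  have hz := invCdf_mem_Icc (A := A) hh hε hx hq
  have hd := (hfl (invCdf H h ε A x q)).1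
  rcases le_or_gt (xMin H h ε A) (fl (invCdf H h ε A x q)) with h1 | h1
  · refine Or.inl ⟨hd, h1, ?_⟩
    rw [← hfl.eq_self (isDouble_xMax hE_min hE_max hA)]
    exact hfl.monotone hz.2
  -- An output below `xMin` is its own rounding, so monotonicity bounds it above by `fl xMin`.
  · refine Or.inr (le_antisymm ?_ (hfl.monotone hz.1))
    rw [← hfl.eq_self hd]
    exact hfl.monotone h1.le

lemma reachable_Icc_eq (hh : 0 < h) (hε : 0 < ε) (hE : eVul h ε ≤ E) (hE_min : -1022 < E)
    (hE_max : E ≤ 1023) (hA : A = bias H h ε E) {fl : ℝ → ℝ} (hfl : IsRoundToNearest fl)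
    (hx : x ∈ Icc (H - h) (H + h)) :
    reachable fl (Icc 0 1) H h ε A x =
      {y | IsDouble y ∧ y ∈ Icc (xMin H h ε A) (xMax H h ε A)} ∪ {fl (xMin H h ε A)} := by
  refine Subset.antisymm (fun y hy => of_mem_reachable hh hε hE_min hE_max hA hfl hx hy) ?_
  rintro y (⟨hd, hlo, hhi⟩ | rfl)
  · rcases hhi.eq_or_lt with rfl | hlt
    · exact xMax_mem_reachable hh hε hE_min hE_max hA hfl hx
    · exact reachable_mono fl Ico_subset_Icc_self
        (Ico_subset_reachable hh hε hE hA hfl hx hd ⟨hlo, hlt⟩)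
  · exact reachable_mono fl Ico_subset_Icc_self (fl_xMin_mem_reachable hh hε fl hx)

/-- `xMax` is removed because only `q = 1` is guaranteed to produce it. -/
lemma reachable_Ico_diff_eq (hh : 0 < h) (hε : 0 < ε) (hE : eVul h ε ≤ E) (hE_min : -1022 < E)
    (hE_max : E ≤ 1023) (hA : A = bias H h ε E) {fl : ℝ → ℝ} (hfl : IsRoundToNearest fl)
    (hx : x ∈ Icc (H - h) (H + h)) :
    reachable fl (Ico 0 1) H h ε A x \ {xMax H h ε A} =
      ({y | IsDouble y ∧ y ∈ Icc (xMin H h ε A) (xMax H h ε A)} ∪ {fl (xMin H h ε A)}) \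
        {xMax H h ε A} := by
  ext y
  refine and_congr_left fun hne => ⟨fun hy => ?_, ?_⟩
  · exact of_mem_reachable hh hε hE_min hE_max hA hfl hx
      (reachable_mono fl Ico_subset_Icc_self hy)
  · rintro (⟨hd, hlo, hhi⟩ | rfl)
    · exact Ico_subset_reachable hh hε hE hA hfl hx hd ⟨hlo, hhi.lt_of_ne hne⟩
    · exact fl_xMin_mem_reachable hh hε fl hx

end Bias

end Zeal

theorem theorem7 (H h ε : ℝ) (hh : 0 < h) (hε : 0 < ε) (E : ℤ)
    (hE : Zeal.eVul h ε ≤ E) (hE_min : -1022 < E) (hE_max : E ≤ 1023)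
    (A : ℝ) (hA : A = Zeal.bias H h ε E)
    (fl : ℝ → ℝ) (hfl : Zeal.IsRoundToNearest fl) :
    -- every double of the output range is reached, whatever the input
    (∀ x ∈ Set.Icc (H - h) (H + h), ∀ y : ℝ, Zeal.IsDouble y →
      y ∈ Set.Icc (Zeal.xMin H h ε A) (Zeal.xMax H h ε A) →
      y ∈ Zeal.reachable fl (Set.Icc 0 1) H h ε A x) ∧
    -- cumulative probabilities below 1 suffice for all of them but the largest
    (∀ x ∈ Set.Icc (H - h) (H + h), ∀ y : ℝ, Zeal.IsDouble y →
      y ∈ Set.Ico (Zeal.xMin H h ε A) (Zeal.xMax H h ε A) →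
      y ∈ Zeal.reachable fl (Set.Ico 0 1) H h ε A x) ∧
    -- no output can be traced back: the image does not depend on the input
    (∀ x ∈ Set.Icc (H - h) (H + h), ∀ x' ∈ Set.Icc (H - h) (H + h),
      Zeal.reachable fl (Set.Icc 0 1) H h ε A x =
        Zeal.reachable fl (Set.Icc 0 1) H h ε A x') ∧
    (∀ x ∈ Set.Icc (H - h) (H + h), ∀ x' ∈ Set.Icc (H - h) (H + h),
      Zeal.reachable fl (Set.Ico 0 1) H h ε A x \ {Zeal.xMax H h ε A} =
        Zeal.reachable fl (Set.Ico 0 1) H h ε A x' \ {Zeal.xMax H h ε A}) := by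
  refine ⟨fun x hx y hy hmem => ?_, fun x hx y hy hmem => ?_, fun x hx x' hx' => ?_,
    fun x hx x' hx' => ?_⟩
  · rw [Zeal.reachable_Icc_eq hh hε hE hE_min hE_max hA hfl hx]
    exact Or.inl ⟨hy, hmem⟩
  · exact Zeal.Ico_subset_reachable hh hε hE hA hfl hx hy hmem
  · rw [Zeal.reachable_Icc_eq hh hε hE hE_min hE_max hA hfl hx,
      Zeal.reachable_Icc_eq hh hε hE hE_min hE_max hA hfl hx']
  · rw [Zeal.reachable_Ico_diff_eq hh hε hE hE_min hE_max hA hfl hx,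
      Zeal.reachable_Ico_diff_eq hh hε hE hE_min hE_max hA hfl hx']
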